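/- Let $m,k,r$ be nonnegative integers with $k\ge m$ and put $n=kr$. For $i\in\{0,1,\dots,m\}$ let $q_i(x)=x^\top A_i x+2b_i^\top x+c_i$ with $A_i\in\mathbb S^n$, $b_i\in\mathbb R^n$, $c_i\in\mathbb R$, where $q_0=q_{\mathrm{obj}}$ is the objective, and let $q(x)=(q_0(x),\dots,q_m(x))\in\mathbb R^{1+m}$. Suppose that every $A_i$, $i\in\{0,1,\dots,m\}$, has the form $A_i=I_k\otimes\mathbb A_i$ for some symmetric $r\times r$ matrix $\mathbb A_i$ (a quadratic matrix program). Define the epigraph $$\mathcal S=\{(x,t)\in\mathbb R^n\times\mathbb R:\ q_0(x)\le 2t,\ q_i(x)\le 0\ \text{for } 1\le i\le m\}$$ and the projected epigraph $\mathcal S_{\mathrm{SDP}}$ of its SDP relaxation, the set of all $(x,t)\in\mathbb R^n\times\mathbb R$ for which there is $X\in\mathbb S^n$ with $X\succeq xx^\top$, $\langle A_0,X\rangle+2b_0^\top x+c_0\le 2t$ and $\langle A_i,X\rangle+2b_i^\top x+c_i\le 0$ for $1\le i\le m$. Let $$\Gamma=\Big\{\gamma\in\mathbb R_+^{1+m}:\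 \sum_{i=0}^m\gamma_iA_i\succeq 0\Big\},\qquad \Gamma^\circ=\{v\in\mathbb R^{1+m}:\ \langle\gamma,v\rangle\le 0\ \text{for all }\gamma\in\Gamma\},$$ and suppose that there is $\gamma^*\in\Gamma$ with $\sum_{i=0}^m\gamma_i^*A_i\succ 0$. For $(x,t)\in\mathcal S_{\mathrm{SDP}}$ let $\mathcal G(x,t)$ be the minimal face of $\Gamma^\circ$ containing $q(x)-2te_0$, where $e_0=(1,0,\dots,0)$, and let $$\mathcal R'(x,t)=\{(x',t')\in\mathbb R^n\times\mathbb R:\ q(x+\alpha x')-2(t+\alpha t')e_0\in\operatorname{span}\mathcal G(x,t)\ \text{for all }\alpha\in\mathbb R\}.$$ Then $\mathcal R'(x,t)$ contains a nonzero vector for every $(x,t)\in\mathcal S_{\mathrm{SDP}}\setminus\mathcal S$, and $\operatorname{conv}(\mathcal S)=\mathcal S_{\mathrm{SDP}}$. -/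

import Mathlib

open scoped Matrix Kronecker

noncomputable section

/-- The polar cone `K° = {v : ⟨γ, v⟩ ≤ 0 for all γ ∈ K}` of a subset `K` of `ℝ^κ`. -/
def polarCone {κ : Type*} [Fintype κ] (K : Set (κ → ℝ)) : PointedCone ℝ (κ → ℝ) where
  carrier := {v | ∀ γ ∈ K, γ ⬝ᵥ v ≤ 0}
  zero_mem' := by
    intro γ _
    simp
  add_mem' := by
    intro u v hu hv γ hγ
    rw [dotProduct_add]
    exact add_nonpos (hu γ hγ) (hv γ hγ)
  smul_mem' := by
    intro a v hv γ hγ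
    rw [← Nonneg.coe_smul, dotProduct_smul, smul_eq_mul]
    exact mul_nonpos_of_nonneg_of_nonpos a.2 (hv γ hγ)

/-- The minimal face of the cone `C` containing the point `v`: the intersection of all the
faces of `C` that contain `v`. -/
def minimalFace {E : Type*} [AddCommGroup E] [Module ℝ E] (C : PointedCone ℝ E) (v : E) :
    PointedCone ℝ E :=
  sInf {F : PointedCone ℝ E | F.IsFaceOf C ∧ v ∈ F}

/-- If `v ∈ C`, then `minimalFace C v` is indeed the least face of `C` containing `v`. -/
theorem minimalFace_isLeast {E : Type*} [AddCommGroup E] [Module ℝ E] (C : PointedCone ℝ E)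
    (v : E) (hv : v ∈ C) :
    IsLeast {F : PointedCone ℝ E | F.IsFaceOf C ∧ v ∈ F} (minimalFace C v) := by
  have hC : minimalFace C v ≤ C := sInf_le ⟨PointedCone.IsFaceOf.refl C, hv⟩
  refine ⟨⟨?_, ?_⟩, fun F hF => sInf_le hF⟩
  · have h := PointedCone.IsFaceOf.sInf (C := C)
      {F : PointedCone ℝ E | F.IsFaceOf C ∧ v ∈ F} (fun F hF => hF.1)
    have h2 : C ⊓ sInf {F : PointedCone ℝ E | F.IsFaceOf C ∧ v ∈ F} = minimalFace C v :=
      inf_eq_right.mpr hC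
    rwa [h2] at h
  · exact Submodule.mem_sInf.mpr fun F hF => hF.2

/-- The data of a quadratically constrained quadratic program on `ℝ^ι` with `m` inequality
constraints: `q i x = xᵀ (A i) x + 2 (b i)ᵀ x + c i`, where the index `0` is the objective and
the indices `1, …, m` are the constraints. -/
structure QCQP (ι : Type*) (m : ℕ) where
  /-- the quadratic parts -/
  A : Fin (m + 1) → Matrix ι ι ℝ
  /-- the linear parts -/
  b : Fin (m + 1) → ι → ℝ
  /-- the constant parts -/
  c : Fin (m + 1) → ℝ
  A_symm : ∀ i, (A i).IsSymm

namespace QCQP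

/-- The quadratic map `q : ℝ^ι → ℝ^{1+m}`. -/
def q {ι : Type*} [Fintype ι] {m : ℕ} (Q : QCQP ι m) (x : ι → ℝ) : Fin (m + 1) → ℝ :=
  fun i => x ⬝ᵥ (Q.A i *ᵥ x) + 2 * (Q.b i ⬝ᵥ x) + Q.c i

/-- The epigraph `S` of the program: `q_obj x ≤ 2 t` and `q_i x ≤ 0` for `i = 1, …, m`. -/
def epigraph {ι : Type*} [Fintype ι] {m : ℕ} (Q : QCQP ι m) : Set ((ι → ℝ) × ℝ) :=
  {p | Q.q p.1 0 ≤ 2 * p.2 ∧ ∀ i : Fin m, Q.q p.1 i.succ ≤ 0}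

/-- The lifted expressions `⟨A i, X⟩ + 2 (b i)ᵀ x + c i`, with `⟨A, X⟩ = tr (Aᵀ X)`. -/
def lifted {ι : Type*} [Fintype ι] {m : ℕ} (Q : QCQP ι m) (x : ι → ℝ) (X : Matrix ι ι ℝ) :
    Fin (m + 1) → ℝ :=
  fun i => ((Q.A i)ᵀ * X).trace + 2 * (Q.b i ⬝ᵥ x) + Q.c i

/-- The projected epigraph `S_SDP` of the standard SDP relaxation: there is a symmetric
`X ⪰ x xᵀ` satisfying the lifted inequalities. -/
def sdpEpigraph {ι : Type*} [Fintype ι] {m : ℕ} (Q : QCQP ι m) : Set ((ι → ℝ) × ℝ) :=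
  {p | ∃ X : Matrix ι ι ℝ, X.IsSymm ∧ (X - Matrix.vecMulVec p.1 p.1).PosSemidef ∧
    Q.lifted p.1 X 0 ≤ 2 * p.2 ∧ ∀ i : Fin m, Q.lifted p.1 X i.succ ≤ 0}

/-- The aggregated matrix `A(γ) = ∑ i, γ i • A i`, with `γ = (γ_obj, γ_1, …, γ_m)`. -/
def aggA {ι : Type*} {m : ℕ} (Q : QCQP ι m) (γ : Fin (m + 1) → ℝ) : Matrix ι ι ℝ :=
  ∑ i, γ i • Q.A i

/-- The cone `Γ` of convex Lagrange multipliers. -/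
def multiplierCone {ι : Type*} {m : ℕ} (Q : QCQP ι m) : Set (Fin (m + 1) → ℝ) :=
  {γ | (∀ i, 0 ≤ γ i) ∧ (Q.aggA γ).PosSemidef}

/-- The definiteness assumption: some `γ ∈ Γ` has `A(γ) ≻ 0`. -/
def HasDefiniteMultiplier {ι : Type*} {m : ℕ} (Q : QCQP ι m) : Prop :=
  ∃ γ ∈ Q.multiplierCone, (Q.aggA γ).PosDef

/-- The vector `q(x) - 2 t e_obj`. -/
def shifted {ι : Type*} [Fintype ι] {m : ℕ} (Q : QCQP ι m) (p : (ι → ℝ) × ℝ) :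
    Fin (m + 1) → ℝ :=
  Q.q p.1 - (2 * p.2) • Pi.single 0 1

/-- `G(x,t)`, the minimal face of `Γ°` containing `q(x) - 2 t e_obj`. -/
def faceG {ι : Type*} [Fintype ι] {m : ℕ} (Q : QCQP ι m) (p : (ι → ℝ) × ℝ) :
    PointedCone ℝ (Fin (m + 1) → ℝ) :=
  minimalFace (polarCone Q.multiplierCone) (Q.shifted p)

/-- `R'(x,t)`: the directions `(x',t')` such that `q(x + α x') - 2 (t + α t') e_obj` lies in the
linear span of `G(x,t)` for every real `α`. -/
def roundingDirections' {ι : Type*} [Fintype ι] {m : ℕ} (Q : QCQP ι m) (p : (ι → ℝ) × ℝ) :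
    Set ((ι → ℝ) × ℝ) :=
  {d | ∀ α : ℝ, Q.shifted (p + α • d) ∈
    Submodule.span ℝ (Q.faceG p : Set (Fin (m + 1) → ℝ))}

/-- The program is a quadratic matrix program in an `r × k` matrix variable: every `A i`
(objective included) has the form `I_k ⊗ 𝔸` with `𝔸` a symmetric `r × r` matrix. The variable is
the vector of the stacked columns, entry `(j, i)` being the `i`-th entry of the `j`-th column. -/
def IsQMP {k r m : ℕ} (Q : QCQP (Fin k × Fin r) m) : Prop :=
  ∀ i, ∃ B : Matrix (Fin r) (Fin r) ℝ, B.IsSymm ∧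
    Q.A i = (1 : Matrix (Fin k) (Fin k) ℝ) ⊗ₖ B

end QCQP

end

/-! Write v for the shifted vector at p. Then p is in the relaxation iff v lies in `slackCone`, and
in the epigraph iff v ≤ 0. Factoring the positive semidefinite slack makes v a nonpositive vector
plus negated quadratic parts of rows of the factor. In a matrix program each row splits further into
single columns. Off the epigraph some column w is nonzero, so its contribution -g(w) is a summand of
v. It therefore lies in any subspace W that contains the summands of v. Directions whose columns are
multiples a_j w have quadratic part |a|² g(w) in W, so only the linear part must be forced into W.
This imposes m + 1 - dim W ≤ m conditions, because g(w) ≠ 0 by definiteness, on the k + 1 > m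
unknowns (a, t). This is `IsQMP.exists_direction`. With W the span of the minimal face of Γ° it
gives the first claim. For the hull, W is `dominatedSubspace` of v in `slackCone`, and one inducts
on dim W. Moving along ±d to the last feasible points strictly shrinks W
(`exists_step_dominatedSubspace_lt`), and p lies between these points. -/

theorem trace_transpose_mul_conjTranspose_mul_self {ι : Type*} [Fintype ι]
    (A B : Matrix ι ι ℝ) : (Aᵀ * (Bᴴ * B)).trace = ∑ j, B j ⬝ᵥ (A *ᵥ B j) := by
  rw [← Matrix.mul_assoc, Matrix.trace_mul_comm, ← Matrix.trace_transpose]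
  simp only [Matrix.transpose_mul, Matrix.transpose_transpose, Matrix.conjTranspose_eq_transpose_of_trivial]
  rw [Matrix.trace]
  refine Finset.sum_congr rfl fun j _ => ?_
  rw [Matrix.diag_apply, Matrix.mul_assoc, Matrix.mul_apply]
  rfl

open scoped MatrixOrder in
theorem Matrix.PosSemidef.exists_eq_conjTranspose_mul_self {ι : Type*} [Fintype ι]
    {Y : Matrix ι ι ℝ} (hY : Y.PosSemidef) : ∃ B : Matrix ι ι ℝ, Y = Bᴴ * B := by
  classical
  obtain ⟨B, hB⟩ := CStarAlgebra.nonneg_iff_eq_star_mul_self.mp hY.nonneg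
  exact ⟨B, hB⟩

/-! ### The cone of slack vectors. -/

namespace QCQP

variable {ι : Type*} [Fintype ι] {m : ℕ}

/-- The vector of the quadratic parts `xᵀ (A i) x`. -/
def quadPart (Q : QCQP ι m) (x : ι → ℝ) : Fin (m + 1) → ℝ := fun i => x ⬝ᵥ (Q.A i *ᵥ x)

/-- The cone of the vectors `v` with `v i + ⟨A i, Y⟩ ≤ 0` for some positive semidefinite `Y`. -/
def slackCone (Q : QCQP ι m) : PointedCone ℝ (Fin (m + 1) → ℝ) where
  carrier := {v | ∃ Y : Matrix ι ι ℝ, Y.PosSemidef ∧ ∀ i, v i + ((Q.A i)ᵀ * Y).trace ≤ 0}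
  zero_mem' := ⟨0, Matrix.PosSemidef.zero, by simp⟩
  add_mem' := by
    rintro u v ⟨Y, hY, hu⟩ ⟨Z, hZ, hv⟩
    refine ⟨Y + Z, hY.add hZ, fun i => ?_⟩
    rw [Matrix.mul_add, Matrix.trace_add, Pi.add_apply]
    linarith [hu i, hv i]
  smul_mem' := by
    rintro a v ⟨Y, hY, hv⟩
    refine ⟨(a : ℝ) • Y, hY.smul a.2, fun i => ?_⟩
    rw [Matrix.mul_smul, Matrix.trace_smul, ← Nonneg.coe_smul, Pi.smul_apply, ← smul_add]
    exact mul_nonpos_of_nonneg_of_nonpos a.2 (hv i)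

/-- Factor Y = BᴴB: its pairing with each `A i` sums the quadratic values over the rows of B. -/
theorem mem_slackCone_iff (Q : QCQP ι m) (v : Fin (m + 1) → ℝ) :
    v ∈ Q.slackCone ↔ ∃ B : ι → ι → ℝ, v + ∑ j, Q.quadPart (B j) ≤ 0 := by
  have key (B : Matrix ι ι ℝ) (i) :
      ((Q.A i)ᵀ * (Bᴴ * B)).trace = (∑ j, Q.quadPart (B j)) i := by
    rw [trace_transpose_mul_conjTranspose_mul_self, Finset.sum_apply]
    rfl
  constructor
  · rintro ⟨Y, hY, hv⟩
    obtain ⟨B, rfl⟩ := hY.exists_eq_conjTranspose_mul_self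
    exact ⟨B, fun i => (congrArg (v i + ·) (key B i)).symm.trans_le (hv i)⟩
  · rintro ⟨B, hB⟩
    refine ⟨_, Matrix.posSemidef_conjTranspose_mul_self (Matrix.of B), fun i => ?_⟩
    rw [key]
    exact hB i

theorem neg_quadPart_mem_slackCone (Q : QCQP ι m) (x : ι → ℝ) :
    -Q.quadPart x ∈ Q.slackCone := by
  refine ⟨_, Matrix.posSemidef_vecMulVec_self_star x, fun i => ?_⟩
  rw [Matrix.mul_vecMulVec, Matrix.trace_vecMulVec, star_trivial, Matrix.mulVec_transpose,
    ← Matrix.dotProduct_mulVec]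
  simp [quadPart]

theorem mem_slackCone_of_nonpos (Q : QCQP ι m) {v : Fin (m + 1) → ℝ} (hv : v ≤ 0) :
    v ∈ Q.slackCone :=
  ⟨0, Matrix.PosSemidef.zero, fun i => by simpa using hv i⟩

theorem dotProduct_quadPart (Q : QCQP ι m) (γ : Fin (m + 1) → ℝ) (x : ι → ℝ) :
    γ ⬝ᵥ Q.quadPart x = x ⬝ᵥ (Q.aggA γ *ᵥ x) := by
  simp_rw [aggA, Matrix.sum_mulVec, dotProduct_sum, Matrix.smul_mulVec, dotProduct_smul]
  rfl

theorem dotProduct_quadPart_nonneg (Q : QCQP ι m) {γ : Fin (m + 1) → ℝ}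
    (hγ : (Q.aggA γ).PosSemidef) (x : ι → ℝ) : 0 ≤ γ ⬝ᵥ Q.quadPart x := by
  rw [dotProduct_quadPart]
  simpa using hγ.dotProduct_mulVec_nonneg x

theorem dotProduct_quadPart_pos (Q : QCQP ι m) {γ : Fin (m + 1) → ℝ}
    (hγ : (Q.aggA γ).PosDef) {x : ι → ℝ} (hx : x ≠ 0) : 0 < γ ⬝ᵥ Q.quadPart x := by
  rw [dotProduct_quadPart]
  simpa using hγ.dotProduct_mulVec_pos hx

/-- Weak duality. This inclusion transfers decompositions of a slack vector to Γ°. -/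
theorem slackCone_le_polarCone (Q : QCQP ι m) :
    Q.slackCone ≤ polarCone Q.multiplierCone := by
  intro v hv γ hγ
  obtain ⟨B, hB⟩ := (Q.mem_slackCone_iff v).1 hv
  have h1 : γ ⬝ᵥ (v + ∑ j, Q.quadPart (B j)) ≤ 0 :=
    Finset.sum_nonpos fun i _ => mul_nonpos_of_nonneg_of_nonpos (hγ.1 i) (hB i)
  rw [dotProduct_add, dotProduct_sum] at h1
  have h2 := Finset.sum_nonneg fun j (_ : j ∈ Finset.univ) =>
    Q.dotProduct_quadPart_nonneg hγ.2 (B j)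
  linarith

theorem mem_epigraph_iff (Q : QCQP ι m) (p : (ι → ℝ) × ℝ) :
    p ∈ Q.epigraph ↔ Q.shifted p ≤ 0 := by
  simp [epigraph, shifted, Pi.le_def, Fin.forall_fin_succ]

/-- Substitute X = Y + xxᵀ. -/
theorem mem_sdpEpigraph_iff (Q : QCQP ι m) (p : (ι → ℝ) × ℝ) :
    p ∈ Q.sdpEpigraph ↔ Q.shifted p ∈ Q.slackCone := by
  have key (Y : Matrix ι ι ℝ) (i) : Q.lifted p.1 (Y + Matrix.vecMulVec p.1 p.1) i =
      Q.q p.1 i + ((Q.A i)ᵀ * Y).trace := by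
    rw [lifted, q, Matrix.mul_add, Matrix.trace_add, Matrix.mul_vecMulVec, Matrix.trace_vecMulVec,
      Matrix.mulVec_transpose, ← Matrix.dotProduct_mulVec]
    ring
  constructor
  · rintro ⟨X, -, hX, h0, hi⟩
    refine ⟨_, hX, Fin.cases ?_ fun i => ?_⟩
    · have := key (X - Matrix.vecMulVec p.1 p.1) 0
      rw [sub_add_cancel] at this
      simp [shifted]
      linarith
    · have := key (X - Matrix.vecMulVec p.1 p.1) i.succ
      rw [sub_add_cancel] at this
      simp [shifted]
      linarith [hi i]
  · rintro ⟨Y, hY, h⟩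
    refine ⟨Y + Matrix.vecMulVec p.1 p.1, ?_, by rwa [add_sub_cancel_right], ?_, fun i => ?_⟩
    · exact Matrix.IsSymm.add ((Matrix.conjTranspose_eq_transpose_of_trivial Y).symm.trans hY.1)
        (Matrix.transpose_vecMulVec _ _)
    · have := h 0
      simp [shifted] at this
      rw [key]
      linarith
    · have := h i.succ
      simp [shifted] at this
      rw [key]
      linarith

/-- The linear part of `shifted` at `p` in the direction `d`. -/
def shiftedLin (Q : QCQP ι m) (x : ι → ℝ) : (ι → ℝ) × ℝ →ₗ[ℝ] (Fin (m + 1) → ℝ) where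
  toFun d := fun i => 2 * ((Q.A i *ᵥ x + Q.b i) ⬝ᵥ d.1) - 2 * d.2 * (Pi.single 0 1 : _ → ℝ) i
  map_add' d e := by
    ext i
    simp only [Prod.fst_add, Prod.snd_add, dotProduct_add, Pi.add_apply]
    ring
  map_smul' a d := by
    ext i
    simp only [Prod.smul_fst, Prod.smul_snd, dotProduct_smul, Pi.smul_apply, smul_eq_mul,
      RingHom.id_apply]
    ring

theorem shifted_add_smul (Q : QCQP ι m) (p d : (ι → ℝ) × ℝ) (α : ℝ) :
    Q.shifted (p + α • d) =
      Q.shifted p + α • Q.shiftedLin p.1 d + α ^ 2 • Q.quadPart d.1 := by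
  ext i
  have h : p.1 ⬝ᵥ (Q.A i *ᵥ d.1) = (Q.A i *ᵥ p.1) ⬝ᵥ d.1 := by
    rw [Matrix.dotProduct_mulVec, ← Matrix.mulVec_transpose, (Q.A_symm i).eq]
  have h' : d.1 ⬝ᵥ (Q.A i *ᵥ p.1) = (Q.A i *ᵥ p.1) ⬝ᵥ d.1 := dotProduct_comm _ _
  simp only [shifted, q, quadPart, shiftedLin, LinearMap.coe_mk, AddHom.coe_mk, Prod.fst_add,
    Prod.snd_add, Prod.smul_fst, Prod.smul_snd, Matrix.mulVec_add, Matrix.mulVec_smul,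
    dotProduct_add, add_dotProduct, dotProduct_smul, smul_dotProduct, Pi.sub_apply, Pi.add_apply,
    Pi.smul_apply, smul_eq_mul, h, h']
  ring

theorem convex_sdpEpigraph (Q : QCQP ι m) : Convex ℝ Q.sdpEpigraph := by
  intro p hp p' hp' a b ha hb hab
  rw [mem_sdpEpigraph_iff] at *
  have h0 := Q.shifted_add_smul p (p' - p) b
  have h1 := Q.shifted_add_smul p (p' - p) 1
  have e0 : p + b • (p' - p) = a • p + b • p' := by
    rw [← eq_sub_iff_add_eq] at hab
    subst hab
    module
  rw [e0] at h0
  rw [one_smul, add_sub_cancel] at h1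
  -- The defect from affinity is a negated quadratic part, which the cone absorbs.
  have h2 : Q.shifted (a • p + b • p') = a • Q.shifted p + b • Q.shifted p' +
      (a * b) • -Q.quadPart (p' - p).1 := by
    rw [h0, h1]
    rw [← eq_sub_iff_add_eq] at hab
    subst hab
    module
  rw [h2]
  refine add_mem (add_mem (Q.slackCone.smul_mem ha hp) (Q.slackCone.smul_mem hb hp')) ?_
  exact Q.slackCone.smul_mem (mul_nonneg ha hb) (Q.neg_quadPart_mem_slackCone _)

theorem epigraph_subset_sdpEpigraph (Q : QCQP ι m) : Q.epigraph ⊆ Q.sdpEpigraph := by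
  intro p hp
  rw [mem_epigraph_iff] at hp
  exact (Q.mem_sdpEpigraph_iff p).2 (Q.mem_slackCone_of_nonpos hp)

end QCQP

/-! ### Directions in quadratic matrix programs. -/

theorem dotProduct_one_kronecker_mulVec {k r : ℕ} (B : Matrix (Fin r) (Fin r) ℝ)
    (x : Fin k × Fin r → ℝ) :
    x ⬝ᵥ (((1 : Matrix (Fin k) (Fin k) ℝ) ⊗ₖ B) *ᵥ x) =
      ∑ j, (fun s => x (j, s)) ⬝ᵥ (B *ᵥ fun s => x (j, s)) := by
  simp [dotProduct, Matrix.mulVec, Fintype.sum_prod_type, Matrix.kroneckerMap_apply,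
    Matrix.one_apply, Finset.sum_ite_eq, ite_mul]

namespace QCQP

variable {k r m : ℕ}

/-- In a quadratic matrix program the quadratic part is a sum over the columns. -/
theorem IsQMP.exists_quadPart_eq_sum {Q : QCQP (Fin k × Fin r) m} (hQ : Q.IsQMP) :
    ∃ g : (Fin r → ℝ) → Fin (m + 1) → ℝ,
      (∀ x, Q.quadPart x = ∑ j, g fun s => x (j, s)) ∧
      ∀ (a : Fin k → ℝ) (w : Fin r → ℝ),
        Q.quadPart (fun s => a s.1 * w s.2) = (a ⬝ᵥ a) • g w := by
  choose D _ hD using hQ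
  have h (x) : Q.quadPart x = ∑ j, fun i => (fun s => x (j, s)) ⬝ᵥ (D i *ᵥ fun s => x (j, s)) := by
    ext i
    rw [quadPart, hD, dotProduct_one_kronecker_mulVec, Finset.sum_apply]
  refine ⟨fun w i => w ⬝ᵥ (D i *ᵥ w), h, fun a w => ?_⟩
  rw [h]
  ext i
  rw [Finset.sum_apply, Pi.smul_apply, smul_eq_mul, dotProduct, Finset.sum_mul]
  refine Finset.sum_congr rfl fun j _ => ?_
  change (a j • w) ⬝ᵥ (D i *ᵥ (a j • w)) = _
  rw [Matrix.mulVec_smul, dotProduct_smul, smul_dotProduct]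
  simp [mul_assoc]

/-- At a point of the relaxation outside the epigraph, the slack vector has a summand that is the
negated quadratic part of a single nonzero column. -/
theorem IsQMP.exists_direction {Q : QCQP (Fin k × Fin r) m} (hQ : Q.IsQMP) (hk : m ≤ k)
    {γ : Fin (m + 1) → ℝ} (hγ : (Q.aggA γ).PosDef) {p : (Fin k × Fin r → ℝ) × ℝ}
    (hp : p ∈ Q.sdpEpigraph) (hp' : p ∉ Q.epigraph) (W : Submodule ℝ (Fin (m + 1) → ℝ))
    (hW : ∀ a ∈ Q.slackCone, ∀ b ∈ Q.slackCone, a + b = Q.shifted p → a ∈ W) :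
    ∃ d ≠ 0, ∀ α : ℝ, Q.shifted (p + α • d) ∈ W := by
  classical
  obtain ⟨g, hg, hga⟩ := hQ.exists_quadPart_eq_sum
  rw [mem_sdpEpigraph_iff] at hp
  rw [mem_epigraph_iff] at hp'
  have hvW : Q.shifted p ∈ W := hW _ hp 0 (zero_mem _) (add_zero _)
  obtain ⟨B, hB⟩ := (Q.mem_slackCone_iff _).1 hp
  obtain ⟨j, l, hjl⟩ : ∃ j l, (fun s => B j (l, s)) ≠ 0 := by
    by_contra! h
    refine hp' (le_of_eq_of_le ?_ hB)
    have hB0 : ∀ j, Q.quadPart (B j) = 0 := fun j => by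
      have : B j = 0 := by
        ext ⟨l, s⟩
        exact congrFun (h j l) s
      rw [this]
      ext i
      simp [quadPart]
    simp [hB0]
  set w := fun s => B j (l, s) with hw
  -- Test the quadratic part on the vector whose only possibly nonzero column, number l, is w'.
  have hgsum : ∀ w', -g w' ∈ Q.slackCone := fun w' => by
    have h := Q.neg_quadPart_mem_slackCone
      fun s => (Pi.single l 1 : Fin k → ℝ) s.1 * w' s.2
    rw [hga] at h
    simpa using h
  have hgW : -g w ∈ W := by
    have hsum : Q.shifted p = -g w + ((Q.shifted p + ∑ j, Q.quadPart (B j)) +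
        (∑ l' ∈ Finset.univ.erase l, -g (fun s => B j (l', s)) +
          ∑ j' ∈ Finset.univ.erase j, -Q.quadPart (B j'))) := by
      rw [← Finset.add_sum_erase _ _ (Finset.mem_univ j), hg (B j),
        ← Finset.add_sum_erase _ _ (Finset.mem_univ l), Finset.sum_neg_distrib,
        Finset.sum_neg_distrib]
      abel
    refine hW _ (hgsum w) _ (add_mem (Q.mem_slackCone_of_nonpos hB) (add_mem ?_ ?_)) hsum.symm
    · exact sum_mem fun l' _ => hgsum _
    · exact sum_mem fun j' _ => Q.neg_quadPart_mem_slackCone _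
  have hg0 : g w ≠ 0 := fun h0 => by
    have hx : (fun s : Fin k × Fin r => (Pi.single l 1 : Fin k → ℝ) s.1 * w s.2) ≠ 0 := fun h =>
      hjl (by ext s; simpa using congrFun h (l, s))
    have := Q.dotProduct_quadPart_pos hγ hx
    simp [hga, h0] at this
  -- The columns of the direction are the multiples of `w`; count dimensions.
  let E : (Fin k → ℝ) × ℝ →ₗ[ℝ] (Fin k × Fin r → ℝ) × ℝ :=
    { toFun := fun a => (fun s => a.1 s.1 * w s.2, a.2)
      map_add' := fun a b => by ext <;> simp [add_mul]
      map_smul' := fun c a => by ext <;> simp [mul_assoc] }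
  have hE : Function.Injective E := by
    rw [← LinearMap.ker_eq_bot, LinearMap.ker_eq_bot']
    rintro ⟨a, t⟩ h
    obtain ⟨s, hs⟩ := Function.ne_iff.1 hjl
    have h1 := congrArg Prod.fst h
    have h2 : t = 0 := congrArg Prod.snd h
    refine Prod.ext (funext fun l' => ?_) h2
    have h3 : a l' * w s = 0 := congrFun h1 (l', s)
    exact (mul_eq_zero.1 h3).resolve_right hs
  let T := W.mkQ ∘ₗ Q.shiftedLin p.1 ∘ₗ E
  have hrank : Module.finrank ℝ ((Fin (m + 1) → ℝ) ⧸ W) <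
      Module.finrank ℝ ((Fin k → ℝ) × ℝ) := by
    have h1 := W.finrank_quotient_add_finrank
    have h2 : 0 < Module.finrank ℝ W := Module.finrank_pos_iff_exists_ne_zero.2
      ⟨⟨_, hgW⟩, fun h => hg0 (neg_eq_zero.1 (congrArg Subtype.val h))⟩
    simp only [Module.finrank_prod, Module.finrank_fin_fun, Module.finrank_self] at *
    omega
  obtain ⟨a, haT, ha0⟩ :=
    Submodule.exists_mem_ne_zero_of_ne_bot (LinearMap.ker_ne_bot_of_finrank_lt (f := T) hrank)
  refine ⟨E a, fun h => ha0 (hE (h.trans (map_zero E).symm)), fun α => ?_⟩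
  rw [shifted_add_smul]
  refine add_mem (add_mem hvW (W.smul_mem _ ?_)) (W.smul_mem _ ?_)
  · exact (Submodule.Quotient.mk_eq_zero W).1 haT
  · change Q.quadPart (fun s => a.1 s.1 * w s.2) ∈ W
    rw [hga]
    exact W.smul_mem _ (neg_mem_iff.1 hgW)

/-- A face containing a sum of two cone elements contains both. -/
theorem mem_span_faceG {ι : Type*} [Fintype ι] (Q : QCQP ι m) (p : (ι → ℝ) × ℝ)
    {a b : Fin (m + 1) → ℝ} (ha : a ∈ Q.slackCone) (hb : b ∈ Q.slackCone)
    (hab : a + b = Q.shifted p) :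
    a ∈ Submodule.span ℝ (Q.faceG p : Set (Fin (m + 1) → ℝ)) := by
  refine Submodule.subset_span ?_
  have ha' := Q.slackCone_le_polarCone ha
  have hb' := Q.slackCone_le_polarCone hb
  have hF := (minimalFace_isLeast (polarCone Q.multiplierCone) (Q.shifted p)
    (hab ▸ add_mem ha' hb')).1
  exact hF.1.mem_of_add_mem_left ha' hb' (hab ▸ hF.2)

end QCQP

/-! ### Comparison of homogeneous functions, and subspaces dominated by a cone element. -/

/-- A positive function, homogeneous of degree two and continuous, dominates every function of the
same kind up to a positive factor. -/
theorem exists_pos_mul_le_of_homogeneous {E : Type*} [NormedAddCommGroup E] [NormedSpace ℝ E]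
    [FiniteDimensional ℝ E] {f g : E → ℝ} (hf : Continuous f) (hg : Continuous g)
    (hf2 : ∀ (a : ℝ) x, f (a • x) = a ^ 2 * f x) (hg2 : ∀ (a : ℝ) x, g (a • x) = a ^ 2 * g x)
    (hpos : ∀ x ≠ 0, 0 < f x) : ∃ ε > 0, ∀ x, ε * g x ≤ f x := by
  have : ProperSpace E := FiniteDimensional.proper ℝ E
  have hS : IsCompact (Metric.sphere (0 : E) 1) := isCompact_sphere 0 1
  obtain ⟨M, hM⟩ := hS.bddAbove_image hg.continuousOn
  obtain ⟨c, hc, hcf⟩ : ∃ c > 0, ∀ x ∈ Metric.sphere (0 : E) 1, c ≤ f x := by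
    rcases (Metric.sphere (0 : E) 1).eq_empty_or_nonempty with h | h
    · exact ⟨1, one_pos, by simp [h]⟩
    · obtain ⟨y, hy, hmin⟩ := hS.exists_isMinOn h hf.continuousOn
      exact ⟨f y, hpos y (ne_zero_of_mem_unit_sphere ⟨y, hy⟩), fun x hx => hmin hx⟩
  have hM1 : 0 < |M| + 1 := by positivity
  refine ⟨c / (|M| + 1), by positivity, fun x => ?_⟩
  rcases eq_or_ne x 0 with rfl | hx
  · have h1 := hf2 0 0
    have h2 := hg2 0 0
    simp_all
  · have hu : ‖x‖⁻¹ • x ∈ Metric.sphere (0 : E) 1 := by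
      simp [norm_smul, hx]
    have hx' : x = ‖x‖ • (‖x‖⁻¹ • x) := by
      rw [smul_smul, mul_inv_cancel₀ (norm_ne_zero_iff.2 hx), one_smul]
    have h1 := hcf _ hu
    have h2 : g (‖x‖⁻¹ • x) ≤ |M| + 1 := (hM ⟨_, hu, rfl⟩).trans (by linarith [le_abs_self M])
    rw [hx', hf2, hg2, mul_left_comm]
    refine mul_le_mul_of_nonneg_left (le_trans ?_ h1) (sq_nonneg _)
    rw [div_mul_eq_mul_div, div_le_iff₀ hM1]
    exact mul_le_mul_of_nonneg_left h2 hc.le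

namespace PointedCone

variable {E : Type*} [AddCommGroup E] [Module ℝ E]

/-- The span of the minimal face of `C` at `v`: the vectors dominated in absolute value by a
multiple of `v`. -/
def dominatedSubspace (C : PointedCone ℝ E) (v : E) : Submodule ℝ E where
  carrier := {w | ∃ s : ℝ, 0 ≤ s ∧ s • v + w ∈ C ∧ s • v - w ∈ C}
  zero_mem' := ⟨0, le_rfl, by simp, by simp⟩
  add_mem' := by
    rintro u w ⟨s, hs, h1, h2⟩ ⟨t, ht, h3, h4⟩
    refine ⟨s + t, add_nonneg hs ht, ?_, ?_⟩
    · convert add_mem h1 h3 using 1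
      module
    · convert add_mem h2 h4 using 1
      module
  smul_mem' := by
    rintro c w ⟨s, hs, h1, h2⟩
    refine ⟨|c| * s, by positivity, ?_⟩
    rcases le_total 0 c with hc | hc
    · rw [abs_of_nonneg hc, mul_smul, ← smul_add, ← smul_sub]
      exact ⟨C.smul_mem hc h1, C.smul_mem hc h2⟩
    · rw [abs_of_nonpos hc]
      constructor
      · convert C.smul_mem (neg_nonneg.2 hc) h2 using 1
        module
      · convert C.smul_mem (neg_nonneg.2 hc) h1 using 1
        module

theorem mem_dominatedSubspace_of_add_eq {C : PointedCone ℝ E} {a b v : E} (ha : a ∈ C)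
    (hb : b ∈ C) (hab : a + b = v) : a ∈ C.dominatedSubspace v := by
  subst hab
  refine ⟨1, zero_le_one, ?_, by simpa using hb⟩
  rw [one_smul]
  exact add_mem (add_mem ha hb) ha

theorem dominatedSubspace_le {C : PointedCone ℝ E} {v v' : E}
    (h : v' ∈ C.dominatedSubspace v) : C.dominatedSubspace v' ≤ C.dominatedSubspace v := by
  obtain ⟨s, hs, -, h1⟩ := h
  rintro w ⟨t, ht, h2, h3⟩
  refine ⟨t * s, mul_nonneg ht hs, ?_, ?_⟩
  · convert add_mem (C.smul_mem ht h1) h2 using 1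
    module
  · convert add_mem (C.smul_mem ht h1) h3 using 1
    module

/-- If sv + w is in C, then v + tw = (1 - ts)v + t(sv + w) is a nonnegative combination for small t.
-/
theorem exists_pos_forall_add_smul_mem {C : PointedCone ℝ E} {v w : E} (hv : v ∈ C)
    (hw : w ∈ C.dominatedSubspace v) : ∃ ε > 0, ∀ t : ℝ, 0 ≤ t → t ≤ ε → v + t • w ∈ C := by
  obtain ⟨s, hs, h, -⟩ := hw
  refine ⟨1 / (s + 1), by positivity, fun t ht hts => ?_⟩
  rw [le_div_iff₀ (by positivity)] at hts
  convert add_mem (C.smul_mem (show 0 ≤ 1 - t * s by linarith) hv) (C.smul_mem ht h) using 1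
  module

end PointedCone

/-! ### Closedness, bounded steps and the convex hull. -/

namespace QCQP

variable {ι : Type*} [Fintype ι] {m : ℕ}

theorem quadPart_smul (Q : QCQP ι m) (a : ℝ) (x : ι → ℝ) :
    Q.quadPart (a • x) = a ^ 2 • Q.quadPart x := by
  ext i
  simp only [quadPart, Matrix.mulVec_smul, dotProduct_smul, smul_dotProduct, Pi.smul_apply,
    smul_eq_mul]
  ring

theorem continuous_quadPart (Q : QCQP ι m) : Continuous Q.quadPart := by
  unfold quadPart
  fun_prop

theorem exists_pos_mul_norm_sq_le (Q : QCQP ι m) {γ : Fin (m + 1) → ℝ}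
    (hγ : (Q.aggA γ).PosDef) : ∃ ε > 0, ∀ x, ε * ‖x‖ ^ 2 ≤ γ ⬝ᵥ Q.quadPart x := by
  refine exists_pos_mul_le_of_homogeneous (by have := Q.continuous_quadPart; fun_prop)
    (by fun_prop) (fun a x => ?_) (fun a x => ?_) fun x hx => Q.dotProduct_quadPart_pos hγ hx
  · rw [quadPart_smul, dotProduct_smul, smul_eq_mul]
  · rw [norm_smul, mul_pow, Real.norm_eq_abs, sq_abs]

/-- The definite multiplier can be chosen with a positive weight on the objective. -/
theorem HasDefiniteMultiplier.exists_pos {Q : QCQP ι m} (h : Q.HasDefiniteMultiplier) :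
    ∃ γ ∈ Q.multiplierCone, (Q.aggA γ).PosDef ∧ 0 < γ 0 := by
  obtain ⟨γ, hγ, hpd⟩ := h
  have hc := Q.continuous_quadPart
  obtain ⟨ε, hε, hle⟩ := exists_pos_mul_le_of_homogeneous
    (f := fun x => γ ⬝ᵥ Q.quadPart x) (g := fun x => -Q.quadPart x 0) (by fun_prop) (by fun_prop)
    (fun a x => by rw [quadPart_smul, dotProduct_smul, smul_eq_mul])
    (fun a x => by simp [quadPart_smul]) fun x hx => Q.dotProduct_quadPart_pos hpd hx
  -- Halving ε leaves at least half of the form of γ, hence strict positivity.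
  have hpd' : (Q.aggA (γ + Pi.single 0 (ε / 2))).PosDef := by
    refine Matrix.PosDef.of_dotProduct_mulVec_pos ?_ fun x hx => ?_
    · rw [Matrix.IsHermitian, Matrix.conjTranspose_eq_transpose_of_trivial, aggA,
        Matrix.transpose_sum]
      simp_rw [Matrix.transpose_smul, (Q.A_symm _).eq]
    · rw [star_trivial, ← dotProduct_quadPart, add_dotProduct, single_dotProduct]
      have h1 := hle x
      have h2 := Q.dotProduct_quadPart_pos hpd hx
      linarith
  refine ⟨_, ⟨fun i => ?_, hpd'.posSemidef⟩, hpd', ?_⟩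
  · have hs : (0 : Fin (m + 1) → ℝ) ≤ Pi.single 0 (ε / 2) :=
      Pi.single_nonneg.2 (half_pos hε).le
    exact add_nonneg (hγ.1 i) (hs i)
  · have := hγ.1 0
    simp
    linarith

theorem dotProduct_nonpos_of_mem_slackCone (Q : QCQP ι m) {γ v : Fin (m + 1) → ℝ}
    (hγ : γ ∈ Q.multiplierCone) (hv : v ∈ Q.slackCone) : γ ⬝ᵥ v ≤ 0 :=
  Q.slackCone_le_polarCone hv γ hγ

/-- Pairing with the definite multiplier bounds the factors B along a convergent sequence, so a
subsequence of them converges. -/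
theorem isClosed_slackCone (Q : QCQP ι m) (h : Q.HasDefiniteMultiplier) :
    IsClosed (Q.slackCone : Set (Fin (m + 1) → ℝ)) := by
  obtain ⟨γ, hγ, hpd⟩ := h
  obtain ⟨ε, hε, hle⟩ := Q.exists_pos_mul_norm_sq_le hpd
  refine IsSeqClosed.isClosed fun v w hv hw => ?_
  choose B hB using fun n => (Q.mem_slackCone_iff (v n)).1 (hv n)
  have hcd : Continuous fun u : Fin (m + 1) → ℝ => -(γ ⬝ᵥ u) := by fun_prop
  obtain ⟨R, hR⟩ := ((hcd.tendsto w).comp hw).bddAbove_range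
  have hbound : ∀ n, B n ∈ Metric.closedBall (0 : ι → ι → ℝ) (√(R / ε)) := fun n => by
    rw [mem_closedBall_zero_iff, pi_norm_le_iff_of_nonneg (Real.sqrt_nonneg _)]
    intro j
    refine Real.le_sqrt_of_sq_le ?_
    rw [le_div_iff₀' hε]
    have h1 : γ ⬝ᵥ (v n + ∑ j, Q.quadPart (B n j)) ≤ 0 :=
      Finset.sum_nonpos fun i _ => mul_nonpos_of_nonneg_of_nonpos (hγ.1 i) (hB n i)
    rw [dotProduct_add, dotProduct_sum] at h1
    have h2 := Finset.single_le_sum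
      (fun j _ => Q.dotProduct_quadPart_nonneg hγ.2 (B n j)) (Finset.mem_univ j)
    have h3 : -(γ ⬝ᵥ v n) ≤ R := hR ⟨n, rfl⟩
    linarith [hle (B n j)]
  obtain ⟨B', -, φ, hφ, hlim⟩ := (isCompact_closedBall _ _).tendsto_subseq hbound
  refine (Q.mem_slackCone_iff w).2 ⟨B', ?_⟩
  have hc : Continuous fun B : ι → ι → ℝ => ∑ j, Q.quadPart (B j) := by
    have := Q.continuous_quadPart
    fun_prop
  exact le_of_tendsto' ((hw.comp hφ.tendsto_atTop).add ((hc.tendsto B').comp hlim))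
    fun n => hB (φ n)

/-- Along a nonzero direction that does not increase the epigraph variable for free, the
feasible steps are bounded. -/
theorem bddAbove_feasible_steps (Q : QCQP ι m) {γ : Fin (m + 1) → ℝ} (hγ : γ ∈ Q.multiplierCone)
    (hpd : (Q.aggA γ).PosDef) (hγ0 : 0 < γ 0) (p : (ι → ℝ) × ℝ) {d : (ι → ℝ) × ℝ}
    (hd : d.1 ≠ 0 ∨ d.1 = 0 ∧ d.2 < 0) :
    BddAbove {α : ℝ | 0 ≤ α ∧ Q.shifted (p + α • d) ∈ Q.slackCone} := by
  have key {α : ℝ} (hα : Q.shifted (p + α • d) ∈ Q.slackCone) :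
      γ ⬝ᵥ Q.shifted p + α * (γ ⬝ᵥ Q.shiftedLin p.1 d) + α ^ 2 * (γ ⬝ᵥ Q.quadPart d.1) ≤ 0 := by
    have := Q.dotProduct_nonpos_of_mem_slackCone hγ hα
    simpa [shifted_add_smul, dotProduct_add, dotProduct_smul] using this
  rcases hd with hd | ⟨hd, hd2⟩
  · have hpos := Q.dotProduct_quadPart_pos hpd hd
    set a := γ ⬝ᵥ Q.quadPart d.1
    set b := γ ⬝ᵥ Q.shiftedLin p.1 d
    set c := γ ⬝ᵥ Q.shifted p
    refine ⟨max 1 ((|b| + |c|) / a), fun α hα => ?_⟩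
    by_contra! hlt
    obtain ⟨h1, h2⟩ := max_lt_iff.1 hlt
    rw [div_lt_iff₀ hpos] at h2
    have h3 : |c| ≤ α * |c| := le_mul_of_one_le_left (abs_nonneg c) h1.le
    have h4 : α * (|b| + |c|) < α * (α * a) := mul_lt_mul_of_pos_left h2 (one_pos.trans h1)
    have h5 : α * (-|b|) ≤ α * b := mul_le_mul_of_nonneg_left (neg_abs_le b) hα.1
    linarith [key hα.2, neg_abs_le c, show α ^ 2 * a = α * (α * a) by ring]
  · have hb : γ ⬝ᵥ Q.shiftedLin p.1 d = -2 * d.2 * γ 0 := by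
      have : Q.shiftedLin p.1 d = Pi.single 0 (-2 * d.2) := by
        ext i
        rcases eq_or_ne i 0 with rfl | hi <;> simp [shiftedLin, *]
      rw [this, dotProduct_single]
      ring
    have hbpos : 0 < -2 * d.2 * γ 0 := mul_pos (by linarith) hγ0
    refine ⟨-(γ ⬝ᵥ Q.shifted p) / (-2 * d.2 * γ 0), fun α hα => ?_⟩
    rw [le_div_iff₀ hbpos]
    have h0 : γ ⬝ᵥ Q.quadPart d.1 = 0 := by
      rw [dotProduct_quadPart, hd, zero_dotProduct]
    have := key hα.2
    rw [hb, h0] at this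
    linarith

/-- The last feasible point in a rounding direction spans a strictly smaller face. -/
theorem exists_step_dominatedSubspace_lt (Q : QCQP ι m) {γ : Fin (m + 1) → ℝ}
    (hγ : γ ∈ Q.multiplierCone) (hpd : (Q.aggA γ).PosDef) (hγ0 : 0 < γ 0)
    {p d : (ι → ℝ) × ℝ} (hp : p ∈ Q.sdpEpigraph)
    (hd : d.1 ≠ 0 ∨ d.1 = 0 ∧ d.2 < 0)
    (hdW : ∀ α : ℝ, Q.shifted (p + α • d) ∈ Q.slackCone.dominatedSubspace (Q.shifted p)) :
    ∃ α : ℝ, 0 ≤ α ∧ p + α • d ∈ Q.sdpEpigraph ∧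
      Q.slackCone.dominatedSubspace (Q.shifted (p + α • d)) <
        Q.slackCone.dominatedSubspace (Q.shifted p) := by
  rw [mem_sdpEpigraph_iff] at hp
  have hclosed : IsClosed {α : ℝ | 0 ≤ α ∧ Q.shifted (p + α • d) ∈ Q.slackCone} := by
    refine isClosed_Ici.inter ((Q.isClosed_slackCone ⟨γ, hγ, hpd⟩).preimage ?_)
    simp_rw [shifted_add_smul]
    fun_prop
  have hbdd := Q.bddAbove_feasible_steps hγ hpd hγ0 p hd
  have hcompact : IsCompact {α : ℝ | 0 ≤ α ∧ Q.shifted (p + α • d) ∈ Q.slackCone} :=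
    Metric.isCompact_of_isClosed_isBounded hclosed
      (isBounded_iff_bddBelow_bddAbove.2 ⟨⟨0, fun α hα => hα.1⟩, hbdd⟩)
  obtain ⟨α, ⟨hα0, hα⟩, hmax⟩ := hcompact.exists_isGreatest ⟨0, le_rfl, by simpa using hp⟩
  refine ⟨α, hα0, (Q.mem_sdpEpigraph_iff _).2 hα,
    lt_of_le_of_ne (PointedCone.dominatedSubspace_le (hdW α)) fun heq => ?_⟩
  -- If the subspace did not shrink, the whole line would stay in it and a further small step would
  -- be feasible, contradicting maximality of α.
  set p' := p + α • d with hp'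
  have hline (β : ℝ) :
      Q.shifted (p' + β • d) ∈ Q.slackCone.dominatedSubspace (Q.shifted p') := by
    rw [heq, hp', add_assoc, ← add_smul]
    exact hdW _
  set W := Q.slackCone.dominatedSubspace (Q.shifted p') with hW
  have h0 := hline 0
  have h1 := hline 1
  have h2 := hline (-1)
  have e1 := Q.shifted_add_smul p' d 1
  have e2 := Q.shifted_add_smul p' d (-1)
  rw [zero_smul, add_zero] at h0
  -- The values at 0, 1 and -1 recover the linear and quadratic coefficients.
  have hlin : Q.shiftedLin p'.1 d ∈ W := by
    convert W.smul_mem (1 / 2 : ℝ) (sub_mem h1 h2) using 1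
    rw [e1, e2]
    module
  have hquad : Q.quadPart d.1 ∈ W := by
    convert sub_mem (W.smul_mem (1 / 2 : ℝ) (add_mem h1 h2)) h0 using 1
    rw [e1, e2]
    module
  obtain ⟨ε, hε, hl⟩ := PointedCone.exists_pos_forall_add_smul_mem hα hlin
  obtain ⟨δ, hδ, hq⟩ := PointedCone.exists_pos_forall_add_smul_mem hα hquad
  obtain ⟨β, hβ, hβ1, hβε, hβδ⟩ : ∃ β : ℝ, 0 < β ∧ β ≤ 1 ∧ 2 * β ≤ ε ∧ 2 * β ≤ δ :=
    ⟨min 1 (min (ε / 2) (δ / 2)), by positivity, min_le_left _ _,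
      by linarith [(min_le_right 1 _).trans (min_le_left (ε / 2) (δ / 2))],
      by linarith [(min_le_right 1 _).trans (min_le_right (ε / 2) (δ / 2))]⟩
  have hmem : Q.shifted (p' + β • d) ∈ Q.slackCone := by
    rw [shifted_add_smul]
    have hβ2 : β ^ 2 ≤ β := by nlinarith
    -- Average the linear step 2β and the quadratic step 2β².
    convert Q.slackCone.smul_mem (show (0 : ℝ) ≤ 1 / 2 by norm_num)
      (add_mem (hl (2 * β) (by positivity) hβε)
        (hq (2 * β ^ 2) (by positivity) (by linarith))) using 1
    module
  have := hmax ⟨add_nonneg hα0 hβ.le, by rwa [add_smul, ← add_assoc]⟩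
  linarith

theorem add_mem_convexHull_epigraph (Q : QCQP ι m) {s : ℝ} (hs : 0 ≤ s) {p : (ι → ℝ) × ℝ}
    (hp : p ∈ convexHull ℝ Q.epigraph) : p + (0, s) ∈ convexHull ℝ Q.epigraph := by
  refine convexHull_min (t := (fun p => p + (0, s)) ⁻¹' convexHull ℝ Q.epigraph)
    (fun p hp => subset_convexHull ℝ _ ?_) ((convex_convexHull ℝ _).translate_preimage_left _) hp
  refine ⟨?_, fun i => ?_⟩
  · have := hp.1
    simp
    linarith
  · simpa using hp.2 i

/-- If every point of the relaxation outside the epigraph has a rounding direction, the relaxation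
is the convex hull of the epigraph. -/
theorem convexHull_epigraph_eq_of_exists_direction (Q : QCQP ι m) (hdef : Q.HasDefiniteMultiplier)
    (hdir : ∀ p ∈ Q.sdpEpigraph \ Q.epigraph, ∃ d ≠ 0, ∀ α : ℝ,
      Q.shifted (p + α • d) ∈ Q.slackCone.dominatedSubspace (Q.shifted p)) :
    convexHull ℝ Q.epigraph = Q.sdpEpigraph := by
  refine (convexHull_min Q.epigraph_subset_sdpEpigraph Q.convex_sdpEpigraph).antisymm ?_
  obtain ⟨γ, hγ, hpd, hγ0⟩ := hdef.exists_pos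
  intro p hp
  induction hN : Module.finrank ℝ (Q.slackCone.dominatedSubspace (Q.shifted p))
    using Nat.strong_induction_on generalizing p with
  | _ N ih =>
    by_cases hpS : p ∈ Q.epigraph
    · exact subset_convexHull ℝ _ hpS
    have step (d : (ι → ℝ) × ℝ) (hd : d.1 ≠ 0 ∨ d.1 = 0 ∧ d.2 < 0)
        (hdW : ∀ α : ℝ, Q.shifted (p + α • d) ∈ Q.slackCone.dominatedSubspace (Q.shifted p)) :
        ∃ α : ℝ, 0 ≤ α ∧ p + α • d ∈ convexHull ℝ Q.epigraph := by
      obtain ⟨α, hα, hmem, hlt⟩ := Q.exists_step_dominatedSubspace_lt hγ hpd hγ0 hp hd hdW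
      exact ⟨α, hα, ih _ (hN ▸ Submodule.finrank_lt_finrank_of_lt hlt) hmem rfl⟩
    obtain ⟨d, hd, hdW⟩ := hdir p ⟨hp, hpS⟩
    have hdW' (α : ℝ) :
        Q.shifted (p + α • -d) ∈ Q.slackCone.dominatedSubspace (Q.shifted p) := by
      simpa using hdW (-α)
    by_cases hd1 : d.1 = 0
    -- For a vertical direction only the downward ray has bounded steps; the hull is closed upward,
    -- so one endpoint suffices.
    · obtain ⟨e, he1, he2, heW⟩ : ∃ e : (ι → ℝ) × ℝ, e.1 = 0 ∧ e.2 < 0 ∧ ∀ α : ℝ,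
          Q.shifted (p + α • e) ∈ Q.slackCone.dominatedSubspace (Q.shifted p) := by
        have hd2 : d.2 ≠ 0 := fun h => hd (Prod.ext hd1 h)
        rcases hd2.lt_or_gt with h | h
        · exact ⟨d, hd1, h, hdW⟩
        · exact ⟨-d, by simpa using hd1, by simpa using h, hdW'⟩
      obtain ⟨α, hα, hmem⟩ := step e (Or.inr ⟨he1, he2⟩) heW
      convert Q.add_mem_convexHull_epigraph
        (mul_nonneg hα (neg_nonneg.2 he2.le)) hmem using 1
      ext <;> simp [he1]
    · obtain ⟨α, hα, hmem⟩ := step d (Or.inl hd1) hdW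
      obtain ⟨β, hβ, hmem'⟩ := step (-d) (Or.inl (by simpa using hd1)) hdW'
      rcases hα.eq_or_lt with rfl | hα'
      · simpa using hmem
      have hne : α + β ≠ 0 := by positivity
      -- These weights balance p + αd and p - βd at p.
      convert convex_convexHull ℝ Q.epigraph hmem hmem'
        (show 0 ≤ β / (α + β) by positivity) (show 0 ≤ α / (α + β) by positivity)
        (by field_simp; ring) using 1
      have h1 : β / (α + β) = 1 - α / (α + β) := by field_simp; ring
      have h2 : α / (α + β) * β = α * (1 - α / (α + β)) := by field_simp; ring
      rw [smul_add, smul_add, smul_neg, smul_neg, smul_smul, smul_smul, h2, h1]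
      module

end QCQP

theorem mainTheorem4 (m k r : ℕ) (hk : m ≤ k) (Q : QCQP (Fin k × Fin r) m)
    (hdef : Q.HasDefiniteMultiplier) (hQMP : Q.IsQMP) :
    (∀ p ∈ Q.sdpEpigraph \ Q.epigraph, ∃ d ∈ Q.roundingDirections' p, d ≠ 0) ∧
      convexHull ℝ Q.epigraph = Q.sdpEpigraph := by
  obtain ⟨γ, -, hpd⟩ := id hdef
  constructor
  · rintro p ⟨hp, hp'⟩
    obtain ⟨d, hd, hdW⟩ := hQMP.exists_direction hk hpd hp hp' _
      fun a ha b hb hab => Q.mem_span_faceG p ha hb hab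
    exact ⟨d, hdW, hd⟩
  · exact Q.convexHull_epigraph_eq_of_exists_direction hdef fun p hp =>
      hQMP.exists_direction hk hpd hp.1 hp.2 _
        fun a ha b hb hab => PointedCone.mem_dominatedSubspace_of_add_eq ha hb hab
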